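/- Let $I=(a,b)$ be an open bounded interval, $a<b$. For $u\in L^1(I)$ let $$J(u)=\sup\Big\{\int_a^b u(x)\,\xi'(x)\,dx \;:\; \xi\in C_0^1(I),\ \|\xi\|_\infty\le 1\Big\}\in[0,\infty]$$ be the total variation of $u$, where $C_0^1(I)$ is the space of continuously differentiable real functions with compact support in $I$. Let $BV(I)=\{u\in L^1(I): J(u)<\infty\}$ and $\|u\|_{BV}=J(u)+\|u\|_{L^1(I)}$. Let $f\in BV(I)$. Then for every $\lambda>0$ the Rudin–Osher–Fatemi functional $$E_\lambda(u)=\lambda J(u)+\tfrac12\|f-u\|_{L^2(I)}^2,\qquad u\in BV(I),$$ has a unique minimizer $u_\lambda\in BV(I)$, and $$J(f-u_\lambda)=J(f)-J(u_\lambda)\qquad\text{for all }\lambda>0 .$$ In particular, both $J(f-u_\lambda)$ and $\|f-u_\lambda\|_{BV}$ tend to zero as $\lambda\to 0+$; that is, $u_\lambda\to f$ strongly in $BV(I)$. -/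

import Mathlib

open MeasureTheory Filter Topology
open scoped ENNReal

noncomputable section

/-- Lebesgue measure on the open interval `I = (a, b)`. -/
abbrev intervalMeasure (a b : ℝ) : Measure ℝ := volume.restrict (Set.Ioo a b)

/-- The space `L¹(I)`, `I = (a, b)`: equivalence classes modulo a.e. equality. -/
abbrev LOne (a b : ℝ) : Type := Lp ℝ 1 (intervalMeasure a b)

/-- The admissible test functions: `ξ ∈ C¹₀(I)` with `‖ξ‖_∞ ≤ 1`. A `C¹` function with compact
support in `I = (a, b)` is identified with its extension by zero to the real line. -/
def testFunctions (a b : ℝ) : Set (ℝ → ℝ) :=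
  {ξ | ContDiff ℝ 1 ξ ∧ HasCompactSupport ξ ∧ tsupport ξ ⊆ Set.Ioo a b ∧ ∀ x, |ξ x| ≤ 1}

/-- The total variation `J(u) = sup { ∫_a^b u ξ' dx : ξ ∈ C¹₀(I), ‖ξ‖_∞ ≤ 1 }`, with values in
`[0, ∞]`. As `ξ = 0` is admissible the supremum is nonnegative, so cutting off the
negative integrals with `ENNReal.ofReal` does not change it. -/
def totalVariation {a b : ℝ} (u : LOne a b) : ℝ≥0∞ :=
  ⨆ ξ ∈ testFunctions a b, ENNReal.ofReal (∫ x in Set.Ioo a b, u x * deriv ξ x)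

theorem integrable_mul_deriv {a b : ℝ} (u : LOne a b) {ξ : ℝ → ℝ} (hξ : ξ ∈ testFunctions a b) :
    Integrable (fun x => u x * deriv ξ x) (intervalMeasure a b) := by
  have hc : Continuous (deriv ξ) := hξ.1.continuous_deriv le_rfl
  obtain ⟨C, hC⟩ := hc.bounded_above_of_compact_support hξ.2.1.deriv
  exact (L1.integrable_coeFn u).mul_bdd (c := C) hc.aestronglyMeasurable (Eventually.of_forall hC)

theorem totalVariation_zero {a b : ℝ} : totalVariation (0 : LOne a b) = 0 := by
  refine le_antisymm (iSup₂_le fun ξ _ => ?_) bot_le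
  have h : ∫ x in Set.Ioo a b, (0 : LOne a b) x * deriv ξ x = 0 := by
    refine integral_eq_zero_of_ae ?_
    filter_upwards [Lp.coeFn_zero ℝ 1 (intervalMeasure a b)] with x hx
    rw [hx]
    exact zero_mul _
  rw [h, ENNReal.ofReal_zero]

theorem totalVariation_add_le {a b : ℝ} (u v : LOne a b) :
    totalVariation (u + v) ≤ totalVariation u + totalVariation v := by
  refine iSup₂_le fun ξ hξ => ?_
  have h : ∫ x in Set.Ioo a b, (u + v : LOne a b) x * deriv ξ x =
      (∫ x in Set.Ioo a b, u x * deriv ξ x) + ∫ x in Set.Ioo a b, v x * deriv ξ x := by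
    rw [← integral_add (integrable_mul_deriv u hξ) (integrable_mul_deriv v hξ)]
    refine integral_congr_ae ?_
    filter_upwards [Lp.coeFn_add u v] with x hx
    rw [hx, Pi.add_apply, add_mul]
  rw [h]
  refine ENNReal.ofReal_add_le.trans (add_le_add ?_ ?_)
  · exact le_iSup₂ (f := fun ξ (_ : ξ ∈ testFunctions a b) =>
      ENNReal.ofReal (∫ x in Set.Ioo a b, u x * deriv ξ x)) ξ hξ
  · exact le_iSup₂ (f := fun ξ (_ : ξ ∈ testFunctions a b) =>
      ENNReal.ofReal (∫ x in Set.Ioo a b, v x * deriv ξ x)) ξ hξ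

theorem neg_mem_testFunctions {a b : ℝ} {ξ : ℝ → ℝ} (hξ : ξ ∈ testFunctions a b) :
    (fun x => -ξ x) ∈ testFunctions a b := by
  obtain ⟨h1, h2, h3, h4⟩ := hξ
  have hs : tsupport (fun x => -ξ x) = tsupport ξ := by
    simp [tsupport, Function.support_fun_neg]
  refine ⟨h1.neg, ?_, hs ▸ h3, fun x => by simpa using h4 x⟩
  unfold HasCompactSupport
  rw [hs]
  exact h2

theorem totalVariation_smul_le {a b : ℝ} (c : ℝ) (u : LOne a b) :
    totalVariation (c • u) ≤ ENNReal.ofReal |c| * totalVariation u := by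
  refine iSup₂_le fun ξ hξ => ?_
  have h : ∫ x in Set.Ioo a b, (c • u : LOne a b) x * deriv ξ x =
      c * ∫ x in Set.Ioo a b, u x * deriv ξ x := by
    rw [← integral_const_mul]
    refine integral_congr_ae ?_
    filter_upwards [Lp.coeFn_smul c u] with x hx
    simp [hx, mul_assoc]
  rw [h]
  rcases le_total 0 c with hc | hc
  · rw [abs_of_nonneg hc, ENNReal.ofReal_mul hc]
    gcongr
    exact le_iSup₂ (f := fun ξ (_ : ξ ∈ testFunctions a b) =>
      ENNReal.ofReal (∫ x in Set.Ioo a b, u x * deriv ξ x)) ξ hξ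
  · have h' : c * ∫ x in Set.Ioo a b, u x * deriv ξ x =
        -c * ∫ x in Set.Ioo a b, u x * deriv (fun y => -ξ y) x := by
      simp [integral_neg]
    rw [h', abs_of_nonpos hc, ENNReal.ofReal_mul (neg_nonneg.2 hc)]
    gcongr
    exact le_iSup₂ (f := fun ξ (_ : ξ ∈ testFunctions a b) =>
      ENNReal.ofReal (∫ x in Set.Ioo a b, u x * deriv ξ x)) _ (neg_mem_testFunctions hξ)

/-- `BV(I) = { u ∈ L¹(I) : J(u) < ∞ }`, a linear subspace of `L¹(I)`. -/
def BV (a b : ℝ) : Submodule ℝ (LOne a b) where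
  carrier := {u | totalVariation u < ∞}
  add_mem' {u v} hu hv := (totalVariation_add_le u v).trans_lt (ENNReal.add_lt_top.2 ⟨hu, hv⟩)
  zero_mem' := by simp [totalVariation_zero]
  smul_mem' c u hu :=
    (totalVariation_smul_le c u).trans_lt (ENNReal.mul_lt_top ENNReal.ofReal_lt_top hu)

/-- The total variation of a function of bounded variation, as a (finite) real number. -/
def BV.J {a b : ℝ} (u : BV a b) : ℝ := (totalVariation (u : LOne a b)).toReal

/-- `‖u‖_BV = J(u) + ‖u‖_{L¹}`. -/
def BV.bvNorm {a b : ℝ} (u : BV a b) : ℝ := BV.J u + ‖(u : LOne a b)‖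

/-- The Rudin–Osher–Fatemi functional `E_l(f; u) = l J(u) + ½ ‖f - u‖²_{L²(I)}`, with values
in `[0, ∞]`. -/
def rofEnergy {a b : ℝ} (f : LOne a b) (l : ℝ) (u : BV a b) : ℝ≥0∞ :=
  ENNReal.ofReal l * totalVariation (u : LOne a b) +
    2⁻¹ * eLpNorm (fun x => f x - (u : LOne a b) x) 2 (intervalMeasure a b) ^ 2

/-- `u` minimizes `E_l(f; ·)` over `BV(I)`. -/
def IsROFMinimizer {a b : ℝ} (f : LOne a b) (l : ℝ) (u : BV a b) : Prop :=
  ∀ v : BV a b, rofEnergy f l u ≤ rofEnergy f l v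

end

/-! Let `K` be the `L²` closure of the derivatives `ξ'` of admissible test functions. Functions in
`BV(I)` are essentially bounded, hence in `L²(I)`, and there `J` is the support function of the
closed convex set `K`. Convex duality then gives the minimizer: `u = f - l q`, where `q` is the
projection of `f / l` onto `K`, and `J(u) = ⟨u, q⟩` (`exists_dual_certificate`).

By the triangle inequality, the identity reduces to `J(u + l q) ≥ J(u) + l J(q)`: some admissible
function must nearly attain `J` at `u` and at `q` simultaneously. Take `η` with `η'` close to `q`,
any admissible `τ`, `r < 1`, and blend them into `ξ = (1 - η^(2m)) r τ + η^(2m) η`. Since `η + (η -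
ξ) / (4m)` is still admissible, `ξ` nearly attains `J(u)` once `η'` is close to `q` for fixed `m`
(`le_inner_blend`). On the other hand `⟨η', ξ'⟩ ≥ r ⟨η', τ'⟩` up to `2m r^(2m) ‖η'‖²` and `r ∫
η^(2m) η' τ'` (`le_inner_derivL2_blend`). Both errors become small for large `m`, the second because
`η^(2m) η'` is the derivative of `η^(2m+1) / (2m+1)`. The limits are taken in
`inner_add_mul_inner_le`.

As `l → 0+`, comparison with `f` gives `u → f` in `L²`; lower semicontinuity and `J(u) ≤ J(f)` give
`J(u) → J(f)`, and the identity turns this into `J(f - u) → 0`. -/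

/-! ### Essential boundedness of functions of bounded variation -/

/-- The difference of two distribution functions with continuous densities supported in `(a, b)`
is an admissible test function. -/
theorem exists_testFunction_deriv_eq_sub {a b c d : ℝ} (hac : a < c) (hdb : d < b)
    {g η : ℝ → ℝ} (hg : Continuous g) (hη : Continuous η) (hg0 : ∀ x, 0 ≤ g x)
    (hη0 : ∀ x, 0 ≤ η x) (hgs : ∀ x, x ∉ Set.Icc c d → g x = 0)
    (hηs : ∀ x, x ∉ Set.Icc c d → η x = 0) (hgi : ∫ x, g x = 1) (hηi : ∫ x, η x = 1) :
    ∃ ξ ∈ testFunctions a b, deriv ξ = fun x => g x - η x := by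
  have cdf : ∀ h : ℝ → ℝ, Continuous h → (∀ x, 0 ≤ h x) → (∀ x, x ∉ Set.Icc c d → h x = 0) →
      ∫ x, h x = 1 → ∀ x, 0 ≤ ∫ t in Set.Iic x, h t ∧ ∫ t in Set.Iic x, h t ≤ 1 ∧
        (x < c → ∫ t in Set.Iic x, h t = 0) ∧ (d < x → ∫ t in Set.Iic x, h t = 1) ∧
        ∫ t in c..x, h t = ∫ t in Set.Iic x, h t := by
    intro h hc h0 hs hi x
    have hint : Integrable h := hc.integrable_of_hasCompactSupport
      (HasCompactSupport.intro isCompact_Icc hs)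
    have hzero : ∀ y ≤ c, ∫ t in Set.Iic y, h t = 0 := by
      intro y hy
      rw [integral_Iic_eq_integral_Iio]
      refine setIntegral_eq_zero_of_forall_eq_zero fun t ht => hs t fun h' => ?_
      exact absurd (lt_of_lt_of_le (Set.mem_Iio.1 ht) hy) (not_lt.2 h'.1)
    refine ⟨integral_nonneg h0, ?_, fun hx => hzero x hx.le, ?_, ?_⟩
    · rw [← hi]
      exact setIntegral_le_integral hint (Eventually.of_forall h0)
    · intro hx
      rw [← hi]
      refine setIntegral_eq_integral_of_forall_compl_eq_zero fun t ht => hs t fun h' => ?_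
      exact ht (h'.2.trans hx.le)
    · have := intervalIntegral.integral_Iic_sub_Iic hint.integrableOn hint.integrableOn
        (a := c) (b := x) (f := h) (μ := volume)
      rw [← this, hzero c le_rfl, sub_zero]
  have hgη : Continuous fun x => g x - η x := hg.sub hη
  -- This primitive vanishes to the right of `d` because both densities have mass one; being a
  -- difference of two numbers in `[0, 1]`, it is bounded by one.
  set ξ : ℝ → ℝ := fun x => ∫ t in c..x, (g t - η t) with hξ
  have hder : ∀ x, HasDerivAt ξ (g x - η x) x := fun x =>
    intervalIntegral.integral_hasDerivAt_right
      (hgη.intervalIntegrable _ _)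
      (hgη.stronglyMeasurableAtFilter _ _) hgη.continuousAt
  have hderiv : deriv ξ = fun x => g x - η x := funext fun x => (hder x).deriv
  have hval : ∀ x, ξ x = (∫ t in Set.Iic x, g t) - ∫ t in Set.Iic x, η t := by
    intro x
    rw [hξ]
    simp only
    rw [intervalIntegral.integral_sub (hg.intervalIntegrable _ _) (hη.intervalIntegrable _ _),
      (cdf g hg hg0 hgs hgi x).2.2.2.2, (cdf η hη hη0 hηs hηi x).2.2.2.2]
  have hout : ∀ x, x ∉ Set.Icc c d → ξ x = 0 := by
    intro x hx
    rw [hval]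
    rw [Set.mem_Icc, not_and_or, not_le, not_le] at hx
    rcases hx with hx | hx
    · rw [(cdf g hg hg0 hgs hgi x).2.2.1 hx, (cdf η hη hη0 hηs hηi x).2.2.1 hx, sub_zero]
    · rw [(cdf g hg hg0 hgs hgi x).2.2.2.1 hx, (cdf η hη hη0 hηs hηi x).2.2.2.1 hx, sub_self]
  refine ⟨ξ, ⟨?_, HasCompactSupport.intro isCompact_Icc hout, ?_, fun x => ?_⟩, hderiv⟩
  · rw [contDiff_one_iff_deriv]
    exact ⟨fun x => (hder x).differentiableAt, hderiv ▸ hgη⟩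
  · have : Function.support ξ ⊆ Set.Icc c d := fun x hx => by
      by_contra h
      exact hx (hout x h)
    refine (closure_minimal this isClosed_Icc).trans fun x hx => ?_
    exact ⟨hac.trans_le hx.1, hx.2.trans_lt hdb⟩
  · rw [hval, abs_le]
    obtain ⟨h1, h2, -⟩ := cdf g hg hg0 hgs hgi x
    obtain ⟨h3, h4, -⟩ := cdf η hη hη0 hηs hηi x
    constructor <;> linarith

theorem BV.integral_le_J {a b : ℝ} (u : BV a b) {ξ : ℝ → ℝ} (hξ : ξ ∈ testFunctions a b) :
    ∫ x in Set.Ioo a b, (u : LOne a b) x * deriv ξ x ≤ BV.J u := by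
  refine (ENNReal.ofReal_le_iff_le_toReal (LT.lt.ne u.2)).1 ?_
  exact le_iSup₂ (f := fun ξ (_ : ξ ∈ testFunctions a b) =>
    ENNReal.ofReal (∫ x in Set.Ioo a b, (u : LOne a b) x * deriv ξ x)) ξ hξ

theorem totalVariation_le_ofReal {a b : ℝ} {u : LOne a b} {C : ℝ}
    (h : ∀ ξ ∈ testFunctions a b, ∫ x in Set.Ioo a b, u x * deriv ξ x ≤ C) :
    totalVariation u ≤ ENNReal.ofReal C :=
  iSup₂_le fun ξ hξ => ENNReal.ofReal_le_ofReal (h ξ hξ)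

theorem zero_mem_testFunctions {a b : ℝ} : (fun _ => 0 : ℝ → ℝ) ∈ testFunctions a b := by
  refine ⟨contDiff_const, HasCompactSupport.zero, ?_, by simp⟩
  rw [show (fun _ => 0 : ℝ → ℝ) = 0 from rfl]
  simp

theorem BV.J_le {a b : ℝ} {u : BV a b} {C : ℝ}
    (h : ∀ ξ ∈ testFunctions a b, ∫ x in Set.Ioo a b, (u : LOne a b) x * deriv ξ x ≤ C) :
    BV.J u ≤ C := by
  refine ENNReal.toReal_le_of_le_ofReal ?_ (totalVariation_le_ofReal h)
  simpa using h _ zero_mem_testFunctions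

theorem BV.J_nonneg {a b : ℝ} (u : BV a b) : 0 ≤ BV.J u := ENNReal.toReal_nonneg

/-- Both `g - η` and `η - g` are derivatives of admissible functions, so two weighted means of `u`
differ by at most its total variation. -/
theorem BV.abs_integral_sub_le {a b c d : ℝ} (u : BV a b) (hac : a < c) (hdb : d < b)
    {g η : ℝ → ℝ} (hg : Continuous g) (hη : Continuous η) (hg0 : ∀ x, 0 ≤ g x)
    (hη0 : ∀ x, 0 ≤ η x) (hgs : ∀ x, x ∉ Set.Icc c d → g x = 0)
    (hηs : ∀ x, x ∉ Set.Icc c d → η x = 0) (hgi : ∫ x, g x = 1) (hηi : ∫ x, η x = 1) :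
    |(∫ x in Set.Ioo a b, (u : LOne a b) x * g x) -
      ∫ x in Set.Ioo a b, (u : LOne a b) x * η x| ≤ BV.J u := by
  have hint : ∀ h : ℝ → ℝ, Continuous h → (∀ x, x ∉ Set.Icc c d → h x = 0) →
      Integrable (fun x => (u : LOne a b) x * h x) (intervalMeasure a b) := by
    intro h hh hs
    obtain ⟨C, hC⟩ := hh.bounded_above_of_compact_support
      (HasCompactSupport.intro isCompact_Icc hs)
    exact (L1.integrable_coeFn _).mul_bdd (c := C) hh.aestronglyMeasurable (Eventually.of_forall hC)
  obtain ⟨ξ, hξ, hd⟩ := exists_testFunction_deriv_eq_sub hac hdb hg hη hg0 hη0 hgs hηs hgi hηi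
  obtain ⟨ζ, hζ, hd'⟩ := exists_testFunction_deriv_eq_sub hac hdb hη hg hη0 hg0 hηs hgs hηi hgi
  have h1 := BV.integral_le_J u hξ
  have h2 := BV.integral_le_J u hζ
  rw [hd] at h1
  rw [hd'] at h2
  simp only [mul_sub] at h1 h2
  rw [integral_sub (hint _ hg hgs) (hint _ hη hηs)] at h1
  rw [integral_sub (hint _ hη hηs) (hint _ hg hgs)] at h2
  rw [abs_le]
  constructor <;> linarith

open scoped Convolution in
/-- A function of bounded variation on a bounded interval is essentially bounded. -/
theorem BV.exists_ae_abs_le {a b : ℝ} (u : BV a b) :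
    ∃ C : ℝ, ∀ᵐ x ∂intervalMeasure a b, |(u : LOne a b) x| ≤ C := by
  rcases le_or_gt b a with hab | hab
  · refine ⟨0, ?_⟩
    simp [intervalMeasure, Set.Ioo_eq_empty (not_lt.2 hab)]
  -- A fixed reference bump at the midpoint: means of `u` over small bumps elsewhere stay within
  -- `J(u)` of the mean against `η`.
  let β : ContDiffBump ((a + b) / 2) := ⟨(b - a) / 8, (b - a) / 4, by linarith, by linarith⟩
  set η : ℝ → ℝ := β.normed volume
  refine ⟨|∫ x in Set.Ioo a b, (u : LOne a b) x * η x| + BV.J u, ?_⟩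
  let φ : ℕ → ContDiffBump (0 : ℝ) := fun k =>
    ⟨1 / (k + 1) / 2, 1 / (k + 1), by positivity, half_lt_self (by positivity)⟩
  have hF : Integrable ((Set.Ioo a b).indicator (u : LOne a b)) := by
    rw [integrable_indicator_iff measurableSet_Ioo]
    exact L1.integrable_coeFn (u : LOne a b)
  have hφ : Tendsto (fun k => (φ k).rOut) atTop (𝓝 0) := tendsto_one_div_add_atTop_nhds_zero_nat
  -- Means over shrinking bumps converge to `u` almost everywhere; `K = 2` is the ratio of outer to
  -- inner radius.
  have hconv := ContDiffBump.ae_convolution_tendsto_right_of_locallyIntegrable (K := 2) hφ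
    (Eventually.of_forall fun k => by
      change 1 / ((k : ℝ) + 1) ≤ 2 * (1 / (k + 1) / 2)
      linarith) hF.locallyIntegrable
  rw [ae_restrict_iff' measurableSet_Ioo]
  filter_upwards [hconv] with x hx hxI
  rw [Set.indicator_of_mem hxI] at hx
  refine le_of_tendsto hx.abs ?_
  -- Once the outer radius is below `δ / 2`, the interval `[c, d]` chosen below contains the
  -- supports of both bumps and stays inside `(a, b)`.
  set δ := min (x - a) (b - x)
  have hδ0 : 0 < δ := lt_min (by linarith [hxI.1]) (by linarith [hxI.2])
  filter_upwards [hφ.eventually (gt_mem_nhds (half_pos hδ0))] with k hk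
  set c := min (x - δ / 2) ((a + b) / 2 - (b - a) / 4)
  set d := max (x + δ / 2) ((a + b) / 2 + (b - a) / 4)
  have hδa : δ ≤ x - a := min_le_left _ _
  have hδb : δ ≤ b - x := min_le_right _ _
  have hac : a < c := lt_min (by linarith) (by linarith)
  have hdb : d < b := max_lt (by linarith) (by linarith)
  have hcx : c ≤ x - δ / 2 := min_le_left _ _
  have hdx : x + δ / 2 ≤ d := le_max_left _ _
  have hcm : c ≤ (a + b) / 2 - (b - a) / 4 := min_le_right _ _
  have hdm : (a + b) / 2 + (b - a) / 4 ≤ d := le_max_right _ _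
  have key := BV.abs_integral_sub_le u (g := fun t => (φ k).normed volume (x - t)) (η := η)
    hac hdb ((φ k).continuous_normed.comp (continuous_const.sub continuous_id))
    β.continuous_normed (fun t => (φ k).nonneg_normed _) (fun t => β.nonneg_normed t) ?_ ?_ ?_
    β.integral_normed
  · have hval : ((φ k).normed volume ⋆[ContinuousLinearMap.lsmul ℝ ℝ, volume]
        (Set.Ioo a b).indicator (u : LOne a b)) x =
        ∫ t in Set.Ioo a b, (u : LOne a b) t * (φ k).normed volume (x - t) := by
      rw [convolution_eq_swap, ← integral_indicator measurableSet_Ioo]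
      refine integral_congr_ae (Eventually.of_forall fun t => ?_)
      by_cases ht : t ∈ Set.Ioo a b
      · simp [ht, mul_comm]
      · simp [ht]
    rw [hval]
    have := abs_sub_abs_le_abs_sub
      (∫ t in Set.Ioo a b, (u : LOne a b) t * (φ k).normed volume (x - t))
      (∫ t in Set.Ioo a b, (u : LOne a b) t * η t)
    linarith
  · intro t ht
    by_contra h
    have : x - t ∈ Metric.ball (0 : ℝ) (φ k).rOut := by
      rw [← (φ k).support_normed_eq (μ := volume)]
      exact h
    rw [mem_ball_zero_iff, Real.norm_eq_abs, abs_lt] at this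
    exact ht ⟨by linarith, by linarith⟩
  · intro t ht
    by_contra h
    have : t ∈ Metric.ball ((a + b) / 2) β.rOut := by
      rw [← β.support_normed_eq (μ := volume)]
      exact h
    rw [Metric.mem_ball, Real.dist_eq, abs_lt] at this
    have h4 : β.rOut = (b - a) / 4 := rfl
    rw [h4] at this
    exact ht ⟨by linarith, by linarith⟩
  · rw [integral_sub_left_eq_self (fun t => (φ k).normed volume t)]
    exact (φ k).integral_normed

theorem BV.memLp_two {a b : ℝ} (u : BV a b) : MemLp (u : LOne a b) 2 (intervalMeasure a b) := by
  obtain ⟨C, hC⟩ := (BV.exists_ae_abs_le u)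
  exact MemLp.of_bound (Lp.aestronglyMeasurable _) C hC

theorem memLp_deriv {a b : ℝ} {ξ : ℝ → ℝ} (hξ : ξ ∈ testFunctions a b) :
    MemLp (deriv ξ) 2 (intervalMeasure a b) :=
  (hξ.1.continuous_deriv le_rfl).memLp_of_hasCompactSupport hξ.2.1.deriv

/-! ### Total variation as a support function in `L²` -/

noncomputable section

/-- The space `L²(I)`, `I = (a, b)`. -/
abbrev LTwo (a b : ℝ) : Type := Lp ℝ 2 (intervalMeasure a b)

/-- The inclusion of `BV(I)` into `L²(I)`. -/
def BV.toL2 {a b : ℝ} (u : BV a b) : LTwo a b := (BV.memLp_two u).toLp _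

/-- The derivative of a test function as an element of `L²(I)`. -/
def derivL2 {a b : ℝ} (ξ : testFunctions a b) : LTwo a b := (memLp_deriv ξ.2).toLp _

end

theorem BV.coeFn_toL2 {a b : ℝ} (u : BV a b) : (BV.toL2 u) =ᵐ[intervalMeasure a b] (u : LOne a b) :=
  (BV.memLp_two u).coeFn_toLp

theorem coeFn_derivL2 {a b : ℝ} (ξ : testFunctions a b) :
    derivL2 ξ =ᵐ[intervalMeasure a b] deriv ξ := (memLp_deriv ξ.2).coeFn_toLp

theorem BV.toL2_sub {a b : ℝ} (u v : BV a b) : (BV.toL2 (u - v)) = (BV.toL2 u) - (BV.toL2 v) := by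
  refine Lp.ext ?_
  filter_upwards [(BV.coeFn_toL2 (u - v)), (BV.coeFn_toL2 u), (BV.coeFn_toL2 v), Lp.coeFn_sub (BV.toL2 u) (BV.toL2 v),
    Lp.coeFn_sub (u : LOne a b) (v : LOne a b)] with x h1 h2 h3 h4 h5
  rw [h1, h4, Pi.sub_apply, h2, h3, Submodule.coe_sub, h5, Pi.sub_apply]

theorem BV.toL2_injective {a b : ℝ} : Function.Injective (BV.toL2 : BV a b → LTwo a b) := by
  intro u v h
  refine Subtype.ext (Lp.ext ?_)
  filter_upwards [(BV.coeFn_toL2 u), (BV.coeFn_toL2 v)] with x h1 h2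
  rw [← h1, ← h2, h]

theorem BV.inner_toL2 {a b : ℝ} (u : BV a b) (ξ : testFunctions a b) :
    inner ℝ (BV.toL2 u) (derivL2 ξ) =
      ∫ x in Set.Ioo a b, (u : LOne a b) x * deriv (ξ : ℝ → ℝ) x := by
  rw [L2.inner_def]
  refine integral_congr_ae ?_
  filter_upwards [(BV.coeFn_toL2 u), coeFn_derivL2 ξ] with x h1 h2
  rw [h1, h2]
  simp [mul_comm]

theorem inner_derivL2 {a b : ℝ} (η ξ : testFunctions a b) :
    inner ℝ (derivL2 η) (derivL2 ξ) =
      ∫ x in Set.Ioo a b, deriv (η : ℝ → ℝ) x * deriv (ξ : ℝ → ℝ) x := by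
  rw [L2.inner_def]
  refine integral_congr_ae ?_
  filter_upwards [coeFn_derivL2 η, coeFn_derivL2 ξ] with x h1 h2
  rw [h1, h2]
  simp [mul_comm]

theorem BV.inner_le_J {a b : ℝ} (u : BV a b) (ξ : testFunctions a b) :
    inner ℝ (BV.toL2 u) (derivL2 ξ) ≤ BV.J u := by
  rw [(BV.inner_toL2 u)]
  exact BV.integral_le_J u ξ.2

theorem BV.J_le_of_inner_le {a b : ℝ} {u : BV a b} {C : ℝ}
    (h : ∀ ξ : testFunctions a b, inner ℝ (BV.toL2 u) (derivL2 ξ) ≤ C) : BV.J u ≤ C :=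
  BV.J_le fun ξ hξ => by
    rw [← (BV.inner_toL2 u) ⟨ξ, hξ⟩]
    exact h ⟨ξ, hξ⟩

/-- Since `I` is bounded, `L² ⊆ L¹`, and the upper bound `C` makes the total variation finite. This
puts the residual of the projection, a priori only in `L²`, into `BV(I)`. -/
theorem exists_toL2_eq {a b : ℝ} {h : LTwo a b} {C : ℝ}
    (hC : ∀ ξ : testFunctions a b, inner ℝ h (derivL2 ξ) ≤ C) : ∃ u : BV a b, (BV.toL2 u) = h := by
  have h1 : MemLp h 1 (intervalMeasure a b) := (Lp.memLp h).mono_exponent one_le_two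
  have hae := h1.coeFn_toLp
  have hu : h1.toLp h ∈ BV a b := by
    refine (totalVariation_le_ofReal (C := C) fun ξ hξ => ?_).trans_lt ENNReal.ofReal_lt_top
    refine le_of_eq_of_le ?_ (hC ⟨ξ, hξ⟩)
    rw [L2.inner_def]
    refine integral_congr_ae ?_
    filter_upwards [hae, coeFn_derivL2 ⟨ξ, hξ⟩] with x h2 h3
    rw [h2, h3]
    simp [mul_comm]
  refine ⟨⟨h1.toLp h, hu⟩, Lp.ext ?_⟩
  filter_upwards [BV.coeFn_toL2 ⟨h1.toLp h, hu⟩, hae] with x h2 h3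
  rw [h2, h3]

theorem BV.norm_le_mul_norm_toL2 {a b : ℝ} (u : BV a b) :
    ‖(u : LOne a b)‖ ≤ ‖(BV.toL2 u)‖ * ((intervalMeasure a b Set.univ) ^ (1 / 2 : ℝ)).toReal := by
  have h := eLpNorm_le_eLpNorm_mul_rpow_measure_univ (μ := intervalMeasure a b)
    (f := (u : LOne a b)) (one_le_two (α := ℝ≥0∞)) (Lp.aestronglyMeasurable _)
  rw [Lp.norm_def, Lp.norm_def, ← ENNReal.toReal_mul, eLpNorm_congr_ae (BV.coeFn_toL2 u)]
  have he : (1 / (1 : ℝ≥0∞).toReal - 1 / (2 : ℝ≥0∞).toReal) = (1 / 2 : ℝ) := by norm_num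
  rw [he] at h
  refine ENNReal.toReal_mono (ENNReal.mul_ne_top (BV.memLp_two u).2.ne ?_) h
  exact ENNReal.rpow_ne_top_of_nonneg (by norm_num) (measure_ne_top _ _)

theorem rofEnergy_eq_ofReal {a b l : ℝ} (hl : 0 < l) (f u : BV a b) :
    rofEnergy (f : LOne a b) l u =
      ENNReal.ofReal (l * BV.J u + 2⁻¹ * ‖(BV.toL2 f) - (BV.toL2 u)‖ ^ 2) := by
  have h1 : eLpNorm (fun x => (f : LOne a b) x - (u : LOne a b) x) 2 (intervalMeasure a b) =
      ENNReal.ofReal ‖(BV.toL2 f) - (BV.toL2 u)‖ := by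
    rw [Lp.norm_def, ENNReal.ofReal_toReal (Lp.eLpNorm_ne_top _)]
    refine eLpNorm_congr_ae ?_
    filter_upwards [(BV.coeFn_toL2 f), (BV.coeFn_toL2 u), Lp.coeFn_sub (BV.toL2 f) (BV.toL2 u)] with x h2 h3 h4
    rw [h4, Pi.sub_apply, h2, h3]
  have h2 : totalVariation (u : LOne a b) = ENNReal.ofReal (BV.J u) :=
    (ENNReal.ofReal_toReal (LT.lt.ne u.2)).symm
  have h3 : (2⁻¹ : ℝ≥0∞) = ENNReal.ofReal 2⁻¹ := by
    rw [ENNReal.ofReal_inv_of_pos two_pos]; simp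
  rw [rofEnergy, h1, h2, h3, ← ENNReal.ofReal_mul hl.le, ← ENNReal.ofReal_pow (norm_nonneg _),
    ← ENNReal.ofReal_mul (by norm_num), ← ENNReal.ofReal_add (mul_nonneg hl.le (BV.J_nonneg u))
    (by positivity)]

theorem isROFMinimizer_iff {a b l : ℝ} (hl : 0 < l) (f u : BV a b) :
    IsROFMinimizer (f : LOne a b) l u ↔ ∀ v : BV a b,
      l * BV.J u + 2⁻¹ * ‖(BV.toL2 f) - (BV.toL2 u)‖ ^ 2 ≤ l * BV.J v + 2⁻¹ * ‖(BV.toL2 f) - (BV.toL2 v)‖ ^ 2 := by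
  refine forall_congr' fun v => ?_
  rw [rofEnergy_eq_ofReal hl, rofEnergy_eq_ofReal hl, ENNReal.ofReal_le_ofReal_iff]
  have := (BV.J_nonneg v)
  positivity

/-! ### Blending admissible test functions -/

/-- For `|s| ≥ r` the first term dominates the second; for `|s| ≤ r` the second is at most `r ^ (2 *
m)`. With `s = η x` and `y = r τ x` this bounds from below the term produced by differentiating the
weight `η ^ (2 * m)`. -/
theorem abs_pow_two_mul_sub_le {r s y : ℝ} {m : ℕ} (hm : m ≠ 0) (hr : 0 ≤ r) (hy : |y| ≤ r) :
    -r ^ (2 * m) ≤ s ^ (2 * m) - s ^ (2 * m - 1) * y := by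
  obtain ⟨k, rfl⟩ := Nat.exists_eq_succ_of_ne_zero hm
  have e : 2 * k.succ - 1 = 2 * k + 1 := by omega
  have e' : 2 * k.succ = 2 * k + 1 + 1 := by omega
  rw [e, e']
  have h1 : s ^ (2 * k + 1) * y ≤ |s| ^ (2 * k + 1) * r := by
    refine (le_abs_self _).trans ?_
    rw [abs_mul, abs_pow]
    gcongr
  have h2 : s ^ (2 * k + 1 + 1) = |s| ^ (2 * k + 1) * |s| := by
    rw [← pow_succ, Even.pow_abs ⟨k + 1, by ring⟩]
  rcases le_total r |s| with h | h
  · have : |s| ^ (2 * k + 1) * r ≤ |s| ^ (2 * k + 1) * |s| := by gcongr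
    have : 0 ≤ r ^ (2 * k + 1 + 1) := by positivity
    linarith
  · have h3 : |s| ^ (2 * k + 1) * r ≤ r ^ (2 * k + 1) * r := by gcongr
    have h4 : 0 ≤ |s| ^ (2 * k + 1) * |s| := by positivity
    rw [pow_succ r (2 * k + 1)]
    linarith

/-- Bernoulli's inequality. It bounds the weight on `r τ` in the blend by the room `1 - |η|` left
below the constraint. -/
theorem one_sub_pow_le (s : ℝ) (m : ℕ) :
    1 - s ^ (2 * m) ≤ 2 * m * (1 - |s|) := by
  have h := one_add_mul_le_pow (a := |s| - 1) (by linarith [abs_nonneg s]) (2 * m)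
  have e : |s| ^ (2 * m) = s ^ (2 * m) := Even.pow_abs ⟨m, by ring⟩ s
  rw [add_sub_cancel, e] at h
  push_cast at h
  linarith

theorem mem_testFunctions_of_eq_zero {a b : ℝ} {η τ ζ : ℝ → ℝ} (hη : η ∈ testFunctions a b)
    (hτ : τ ∈ testFunctions a b) (hζ : ContDiff ℝ 1 ζ)
    (h0 : ∀ x, η x = 0 → τ x = 0 → ζ x = 0) (h1 : ∀ x, |ζ x| ≤ 1) : ζ ∈ testFunctions a b := by
  have hsub : tsupport ζ ⊆ tsupport η ∪ tsupport τ := by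
    rw [tsupport, tsupport, tsupport, ← closure_union]
    refine closure_mono fun x hx => ?_
    by_contra h
    rw [Set.mem_union, not_or, Function.notMem_support, Function.notMem_support] at h
    exact hx (h0 x h.1 h.2)
  exact ⟨hζ, (hη.2.1.isCompact.union hτ.2.1.isCompact).of_isClosed_subset
    (isClosed_tsupport _) hsub, hsub.trans (Set.union_subset hη.2.2.1 hτ.2.2.1), h1⟩

theorem convex_range_derivL2 (a b : ℝ) : Convex ℝ (Set.range (derivL2 (a := a) (b := b))) := by
  rintro _ ⟨η, rfl⟩ _ ⟨τ, rfl⟩ s t hs ht hst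
  have hmem : (fun x => s * (η : ℝ → ℝ) x + t * (τ : ℝ → ℝ) x) ∈ testFunctions a b := by
    refine mem_testFunctions_of_eq_zero η.2 τ.2
      ((contDiff_const.mul η.2.1).add (contDiff_const.mul τ.2.1)) (fun x h h' => by simp [h, h'])
      fun x => ?_
    have h1 := η.2.2.2.2 x
    have h2 := τ.2.2.2.2 x
    calc _ ≤ |s * (η : ℝ → ℝ) x| + |t * (τ : ℝ → ℝ) x| := abs_add_le _ _
      _ = s * |(η : ℝ → ℝ) x| + t * |(τ : ℝ → ℝ) x| := by
        rw [abs_mul, abs_mul, abs_of_nonneg hs, abs_of_nonneg ht]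
      _ ≤ s * 1 + t * 1 := by gcongr
      _ = 1 := by linarith
  refine ⟨⟨_, hmem⟩, Lp.ext ?_⟩
  filter_upwards [coeFn_derivL2 ⟨_, hmem⟩, coeFn_derivL2 η, coeFn_derivL2 τ,
    Lp.coeFn_add (s • derivL2 η) (t • derivL2 τ), Lp.coeFn_smul s (derivL2 η),
    Lp.coeFn_smul t (derivL2 τ)] with x h1 h2 h3 h4 h5 h6
  rw [h1, h4, Pi.add_apply, h5, h6, Pi.smul_apply, Pi.smul_apply, h2, h3]
  have d1 := ((η.2.1.differentiable one_ne_zero) x).hasDerivAt.const_mul s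
  have d2 := ((τ.2.1.differentiable one_ne_zero) x).hasDerivAt.const_mul t
  exact (d1.add d2).deriv

/-- Test functions composed with odd powers oscillate weakly little: the integral of
`(η ^ (2m+1))' τ' / (2m+1)` is small for large `m`, uniformly in `η` with bounded energy. -/
theorem exists_abs_integral_pow_mul_le {a b : ℝ} (hab : a ≤ b) (τ : testFunctions a b) {ε : ℝ}
    (hε : 0 < ε) : ∃ K : ℝ, ∀ (η : testFunctions a b) (m : ℕ),
      |∫ x in Set.Ioo a b, (η : ℝ → ℝ) x ^ (2 * m) * deriv (η : ℝ → ℝ) x * deriv (τ : ℝ → ℝ) x| ≤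
        ε * ((b - a) + ‖derivL2 η‖ ^ 2) + K / (2 * m + 1) := by
  -- As `τ'` is merely continuous, it is replaced by a polynomial before integrating by parts. The
  -- replacement costs `ε ∫ |η'|`, bounded through `|η'| ≤ 1 + η'²`; the boundary terms vanish with
  -- `η`.
  obtain ⟨P, hP⟩ := exists_polynomial_near_of_continuousOn a b (deriv τ)
    (τ.2.1.continuous_deriv le_rfl).continuousOn ε hε
  obtain ⟨C, hC⟩ := isCompact_Icc.exists_bound_of_continuousOn (s := Set.Icc a b)
    (P.derivative.continuous.continuousOn)
  have hC0 : 0 ≤ C := (norm_nonneg _).trans (hC a ⟨le_rfl, hab⟩)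
  refine ⟨C * (b - a), fun η m => ?_⟩
  have hηc := η.2.1.continuous
  have hη'c := η.2.1.continuous_deriv le_rfl
  have hτ'c := τ.2.1.continuous_deriv le_rfl
  have hint : ∀ g : ℝ → ℝ, Continuous g → Integrable g (intervalMeasure a b) := fun g hg =>
    (hg.integrableOn_Icc (a := a) (b := b)).mono_set Set.Ioo_subset_Icc_self
  have hnorm : ‖derivL2 η‖ ^ 2 = ∫ x in Set.Ioo a b, deriv (η : ℝ → ℝ) x ^ 2 := by
    rw [← real_inner_self_eq_norm_sq, inner_derivL2]
    simp only [sq]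
  have hvol : ∫ _ in Set.Ioo a b, (1 : ℝ) = b - a := by
    simp [hab]
  have h1 : ∀ x, |(η : ℝ → ℝ) x ^ (2 * m)| ≤ 1 := fun x => by
    rw [abs_pow]
    exact pow_le_one₀ (abs_nonneg _) (η.2.2.2.2 x)
  have hsplit : ∫ x in Set.Ioo a b,
      (η : ℝ → ℝ) x ^ (2 * m) * deriv (η : ℝ → ℝ) x * deriv (τ : ℝ → ℝ) x =
      (∫ x in Set.Ioo a b, (η : ℝ → ℝ) x ^ (2 * m) * deriv (η : ℝ → ℝ) x *
        (deriv (τ : ℝ → ℝ) x - P.eval x)) +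
      ∫ x in Set.Ioo a b, (η : ℝ → ℝ) x ^ (2 * m) * deriv (η : ℝ → ℝ) x * P.eval x := by
    rw [← integral_add (hint _ (by fun_prop)) (hint _ (by fun_prop))]
    congr 1 with x
    ring
  have hA : |∫ x in Set.Ioo a b, (η : ℝ → ℝ) x ^ (2 * m) * deriv (η : ℝ → ℝ) x *
      (deriv (τ : ℝ → ℝ) x - P.eval x)| ≤ ε * ((b - a) + ‖derivL2 η‖ ^ 2) := by
    rw [hnorm, ← hvol, ← integral_add (hint _ (by fun_prop)) (hint _ (by fun_prop)),
      ← integral_const_mul, ← Real.norm_eq_abs]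
    refine norm_integral_le_of_norm_le (hint _ (by fun_prop)) ?_
    refine (ae_restrict_iff' measurableSet_Ioo).2 (Eventually.of_forall fun x hx => ?_)
    rw [Real.norm_eq_abs, abs_mul, abs_mul]
    have h2 : |deriv (τ : ℝ → ℝ) x - P.eval x| ≤ ε := by
      rw [abs_sub_comm]
      exact (hP x (Set.Ioo_subset_Icc_self hx)).le
    have h3 : |deriv (η : ℝ → ℝ) x| ≤ 1 + deriv (η : ℝ → ℝ) x ^ 2 := by
      rw [← sq_abs]
      nlinarith [sq_nonneg (|deriv (η : ℝ → ℝ) x| - 1)]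
    calc _ ≤ 1 * (1 + deriv (η : ℝ → ℝ) x ^ 2) * ε := by
          gcongr
          exact h1 x
      _ = _ := by ring
  have hB : |∫ x in Set.Ioo a b, (η : ℝ → ℝ) x ^ (2 * m) * deriv (η : ℝ → ℝ) x * P.eval x| ≤
      C * (b - a) / (2 * m + 1) := by
    have hη0 : ∀ x, x ∉ Set.Ioo a b → (η : ℝ → ℝ) x = 0 := fun x hx =>
      image_eq_zero_of_notMem_tsupport fun h => hx (η.2.2.2.1 h)
    have hparts := intervalIntegral.integral_deriv_mul_eq_sub (a := a) (b := b)
      (u := fun x => (η : ℝ → ℝ) x ^ (2 * m + 1) / (2 * m + 1))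
      (u' := fun x => (η : ℝ → ℝ) x ^ (2 * m) * deriv (η : ℝ → ℝ) x)
      (v := fun x => P.eval x) (v' := fun x => P.derivative.eval x)
      (fun x _ => by
        have d := ((((η.2.1.differentiable one_ne_zero) x).hasDerivAt).pow (2 * m + 1)).div_const
          (2 * (m : ℝ) + 1)
        refine d.congr_deriv ?_
        have : (2 * (m : ℝ) + 1) ≠ 0 := by positivity
        push_cast
        field_simp)
      (fun x _ => P.hasDerivAt x)
      ((by fun_prop : Continuous fun x =>
        (η : ℝ → ℝ) x ^ (2 * m) * deriv (η : ℝ → ℝ) x).intervalIntegrable _ _)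
      (P.derivative.continuous.intervalIntegrable _ _)
    rw [hη0 a (by simp), hη0 b (by simp), intervalIntegral.integral_of_le hab,
      integral_Ioc_eq_integral_Ioo, integral_add (hint _ (by fun_prop)) (hint _ (by fun_prop))]
      at hparts
    have hparts' : ∫ x in Set.Ioo a b, (η : ℝ → ℝ) x ^ (2 * m) * deriv (η : ℝ → ℝ) x * P.eval x =
        -∫ x in Set.Ioo a b, (η : ℝ → ℝ) x ^ (2 * m + 1) / (2 * m + 1) * P.derivative.eval x := by
      simp only [ne_eq, Nat.add_eq_zero_iff, one_ne_zero, and_false, not_false_eq_true, zero_pow,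
        zero_div, zero_mul, sub_self] at hparts
      linarith
    rw [hparts', abs_neg, ← Real.norm_eq_abs]
    have : C * (b - a) / (2 * m + 1) = ∫ x in Set.Ioo a b, C / (2 * m + 1) * (1 : ℝ) := by
      rw [integral_const_mul, hvol]
      ring
    rw [this]
    refine norm_integral_le_of_norm_le (hint _ (by fun_prop)) ?_
    refine (ae_restrict_iff' measurableSet_Ioo).2 (Eventually.of_forall fun x hx => ?_)
    have h2 := hC x (Set.Ioo_subset_Icc_self hx)
    rw [norm_mul, norm_div, Real.norm_of_nonneg (by positivity : (0 : ℝ) ≤ 2 * m + 1), norm_pow]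
    calc _ ≤ 1 / (2 * (m : ℝ) + 1) * C := by
          gcongr
          exact pow_le_one₀ (abs_nonneg _) (η.2.2.2.2 x)
      _ = _ := by ring
  rw [hsplit]
  exact (abs_add_le _ _).trans (add_le_add hA hB)

noncomputable section

/-- Interpolation between the test functions `r τ` and `η`, close to `η` where `|η|` is close to
one and close to `r τ` elsewhere. -/
def blendFun (η τ : ℝ → ℝ) (r : ℝ) (m : ℕ) (x : ℝ) : ℝ :=
  (1 - η x ^ (2 * m)) * (r * τ x) + η x ^ (2 * m) * η x

end

section blend

theorem contDiff_blendFun {η τ : ℝ → ℝ} (hη : ContDiff ℝ 1 η) (hτ : ContDiff ℝ 1 τ) (r : ℝ)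
    (m : ℕ) : ContDiff ℝ 1 (blendFun η τ r m) :=
  ((contDiff_const.sub (hη.pow _)).mul (contDiff_const.mul hτ)).add ((hη.pow _).mul hη)

theorem deriv_blendFun {η τ : ℝ → ℝ} (hη : ContDiff ℝ 1 η) (hτ : ContDiff ℝ 1 τ) (r : ℝ)
    (m : ℕ) (x : ℝ) : deriv (blendFun η τ r m) x =
      (1 - η x ^ (2 * m)) * (r * deriv τ x) + η x ^ (2 * m) * deriv η x +
        2 * m * η x ^ (2 * m - 1) * deriv η x * (η x - r * τ x) := by
  have d1 := ((hη.differentiable one_ne_zero) x).hasDerivAt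
  have d2 := ((hτ.differentiable one_ne_zero) x).hasDerivAt
  have d := (((d1.pow (2 * m)).const_sub 1).mul (d2.const_mul r)).add ((d1.pow (2 * m)).mul d1)
  refine d.deriv.trans ?_
  simp only [Pi.pow_apply]
  push_cast
  ring

theorem pow_two_mul_mem_Icc {s : ℝ} (hs : |s| ≤ 1) (m : ℕ) :
    0 ≤ s ^ (2 * m) ∧ s ^ (2 * m) ≤ 1 := by
  rw [← Even.pow_abs ⟨m, by ring⟩ s]
  exact ⟨by positivity, pow_le_one₀ (abs_nonneg _) hs⟩

theorem blendFun_mem {a b r : ℝ} {η τ : ℝ → ℝ} (hη : η ∈ testFunctions a b)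
    (hτ : τ ∈ testFunctions a b) (hr0 : 0 ≤ r) (hr1 : r ≤ 1) (m : ℕ) :
    blendFun η τ r m ∈ testFunctions a b := by
  refine mem_testFunctions_of_eq_zero hη hτ (contDiff_blendFun hη.1 hτ.1 r m)
    (fun x h h' => by simp [blendFun, h, h']) fun x => ?_
  obtain ⟨h0, h1⟩ := pow_two_mul_mem_Icc (hη.2.2.2 x) m
  have h2 : |r * τ x| ≤ 1 := by
    rw [abs_mul, abs_of_nonneg hr0]
    exact mul_le_one₀ hr1 (abs_nonneg _) (hτ.2.2.2 x)
  calc |blendFun η τ r m x| ≤ |(1 - η x ^ (2 * m)) * (r * τ x)| + |η x ^ (2 * m) * η x| :=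
        abs_add_le _ _
    _ = (1 - η x ^ (2 * m)) * |r * τ x| + η x ^ (2 * m) * |η x| := by
        rw [abs_mul (1 - _), abs_mul (η x ^ _), abs_of_nonneg h0, abs_of_nonneg (sub_nonneg.2 h1)]
    _ ≤ (1 - η x ^ (2 * m)) * 1 + η x ^ (2 * m) * 1 := by
        have := sub_nonneg.2 h1
        have := hη.2.2.2 x
        gcongr
    _ = 1 := by ring

/-- The blend stays admissible when it is reflected, to a small extent, through `η`. -/
theorem sub_blendFun_mem {a b r : ℝ} {η τ : ℝ → ℝ} (hη : η ∈ testFunctions a b)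
    (hτ : τ ∈ testFunctions a b) (hr0 : 0 ≤ r) (hr1 : r ≤ 1) {m : ℕ} (hm : m ≠ 0) :
    (fun x => (1 + 1 / (4 * m : ℝ)) * η x - 1 / (4 * m : ℝ) * blendFun η τ r m x) ∈
      testFunctions a b := by
  refine mem_testFunctions_of_eq_zero hη hτ ((contDiff_const.mul hη.1).sub
    (contDiff_const.mul (contDiff_blendFun hη.1 hτ.1 r m)))
    (fun x h h' => by simp [blendFun, h, h']) fun x => ?_
  obtain ⟨h0, h1⟩ := pow_two_mul_mem_Icc (hη.2.2.2 x) m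
  have h2 : |r * τ x| ≤ 1 := by
    rw [abs_mul, abs_of_nonneg hr0]
    exact mul_le_one₀ hr1 (abs_nonneg _) (hτ.2.2.2 x)
  have h3 : |η x - r * τ x| ≤ 2 :=
    (abs_sub _ _).trans (by linarith [hη.2.2.2 x])
  have hm' : (0 : ℝ) < m := by exact_mod_cast Nat.pos_of_ne_zero hm
  -- The perturbation of `η` is at most `1 / (4m) · 2m (1 - |η|) · 2 = 1 - |η|`, which explains the
  -- factor `1 / (4m)`.
  have e : (1 + 1 / (4 * m : ℝ)) * η x - 1 / (4 * m : ℝ) * blendFun η τ r m x =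
      η x + 1 / (4 * m : ℝ) * ((1 - η x ^ (2 * m)) * (η x - r * τ x)) := by
    rw [blendFun]
    ring
  rw [e]
  calc _ ≤ |η x| + |1 / (4 * m : ℝ) * ((1 - η x ^ (2 * m)) * (η x - r * τ x))| := abs_add_le _ _
    _ = |η x| + 1 / (4 * m : ℝ) * ((1 - η x ^ (2 * m)) * |η x - r * τ x|) := by
        rw [abs_mul, abs_mul, abs_of_nonneg (sub_nonneg.2 h1),
          abs_of_pos (by positivity : 0 < 1 / (4 * m : ℝ))]
    _ ≤ |η x| + 1 / (4 * m : ℝ) * ((2 * m * (1 - |η x|)) * 2) := by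
        gcongr
        · linarith [abs_nonneg (η x), hη.2.2.2 x, one_sub_pow_le (η x) m]
        · exact one_sub_pow_le (η x) m
    _ = 1 := by
        field_simp
        ring

variable {a b : ℝ}

/-- The blend of two test functions. -/
noncomputable def blend (η τ : testFunctions a b) (r : Set.Icc (0 : ℝ) 1) (m : ℕ) :
    testFunctions a b := ⟨blendFun η τ r m, blendFun_mem η.2 τ.2 r.2.1 r.2.2 m⟩

/-- Test `hu` with the reflected function `η + (η - ξ) / (4m)`, where `ξ` is the blend, and solve
for the pairing with `ξ'`. For fixed `m`, if `η` nearly attains `A`, so does `ξ`. -/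
theorem le_inner_blend (η τ : testFunctions a b) (r : Set.Icc (0 : ℝ) 1) {m : ℕ} (hm : m ≠ 0)
    {u : LTwo a b} {A : ℝ} (hu : ∀ ξ : testFunctions a b, inner ℝ u (derivL2 ξ) ≤ A) :
    inner ℝ u (derivL2 η) - 4 * m * (A - inner ℝ u (derivL2 η)) ≤
      inner ℝ u (derivL2 (blend η τ r m)) := by
  have hmem := sub_blendFun_mem η.2 τ.2 r.2.1 r.2.2 hm
  have hm' : (0 : ℝ) < m := by exact_mod_cast Nat.pos_of_ne_zero hm
  have e : derivL2 ⟨_, hmem⟩ = (1 + 1 / (4 * m : ℝ)) • derivL2 η -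
      (1 / (4 * m : ℝ)) • derivL2 (blend η τ r m) := by
    refine Lp.ext ?_
    filter_upwards [coeFn_derivL2 ⟨_, hmem⟩, coeFn_derivL2 η, coeFn_derivL2 (blend η τ r m),
      Lp.coeFn_sub ((1 + 1 / (4 * m : ℝ)) • derivL2 η)
        ((1 / (4 * m : ℝ)) • derivL2 (blend η τ r m)),
      Lp.coeFn_smul (1 + 1 / (4 * m : ℝ)) (derivL2 η),
      Lp.coeFn_smul (1 / (4 * m : ℝ)) (derivL2 (blend η τ r m))] with x h1 h2 h3 h4 h5 h6
    rw [h1, h4, Pi.sub_apply, h5, h6, Pi.smul_apply, Pi.smul_apply, h2, h3]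
    have d1 := ((η.2.1.differentiable one_ne_zero) x).hasDerivAt.const_mul (1 + 1 / (4 * m : ℝ))
    have d2 := (((blend η τ r m).2.1.differentiable one_ne_zero) x).hasDerivAt.const_mul
      (1 / (4 * m : ℝ))
    exact (d1.sub d2).deriv
  have h := hu ⟨_, hmem⟩
  rw [e, inner_sub_right, inner_smul_right, inner_smul_right] at h
  have h' := mul_le_mul_of_nonneg_left h (by positivity : (0 : ℝ) ≤ 4 * m)
  have e2 : 4 * (m : ℝ) * ((1 + 1 / (4 * m : ℝ)) * inner ℝ u (derivL2 η) -
      1 / (4 * m : ℝ) * inner ℝ u (derivL2 (blend η τ r m))) =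
      4 * m * inner ℝ u (derivL2 η) + inner ℝ u (derivL2 η) -
        inner ℝ u (derivL2 (blend η τ r m)) := by
    field_simp
  rw [e2] at h'
  linarith

/-- A crude bound suffices: for fixed `m` it only multiplies `‖q - η'‖`, which tends to zero. -/
theorem norm_derivL2_blend_le (η τ : testFunctions a b) (r : Set.Icc (0 : ℝ) 1) (m : ℕ) :
    ‖derivL2 (blend η τ r m)‖ ≤ ‖derivL2 τ‖ + (1 + 4 * m) * ‖derivL2 η‖ := by
  have h : ‖derivL2 (blend η τ r m)‖ ≤ ‖|derivL2 τ| + (1 + 4 * m : ℝ) • |derivL2 η|‖ := by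
    refine Lp.norm_le_norm_of_ae_le ?_
    filter_upwards [coeFn_derivL2 (blend η τ r m), coeFn_derivL2 η, coeFn_derivL2 τ,
      Lp.coeFn_add |derivL2 τ| ((1 + 4 * m : ℝ) • |derivL2 η|), Lp.coeFn_abs (derivL2 τ),
      Lp.coeFn_smul (1 + 4 * m : ℝ) |derivL2 η|, Lp.coeFn_abs (derivL2 η)]
      with x h1 h2 h3 h4 h5 h6 h7
    rw [h1, h4, Pi.add_apply, h5, h6, Pi.smul_apply, h7, h2, h3]
    refine le_trans ?_ (le_abs_self _)
    rw [Real.norm_eq_abs, smul_eq_mul]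
    change |deriv (blendFun η τ r m) x| ≤ _
    rw [deriv_blendFun η.2.1 τ.2.1]
    obtain ⟨g0, g1⟩ := pow_two_mul_mem_Icc (η.2.2.2.2 x) m
    have g2 : |(r : ℝ)| ≤ 1 := by rw [abs_of_nonneg r.2.1]; exact r.2.2
    have g3 : |(η : ℝ → ℝ) x - r * (τ : ℝ → ℝ) x| ≤ 2 := by
      have : |(r : ℝ) * (τ : ℝ → ℝ) x| ≤ 1 := by
        rw [abs_mul]
        exact mul_le_one₀ g2 (abs_nonneg _) (τ.2.2.2.2 x)
      exact (abs_sub _ _).trans (by linarith [η.2.2.2.2 x])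
    have g4 : |(η : ℝ → ℝ) x ^ (2 * m - 1)| ≤ 1 := by
      rw [abs_pow]
      exact pow_le_one₀ (abs_nonneg _) (η.2.2.2.2 x)
    refine (abs_add_three _ _ _).trans ?_
    simp only [abs_mul, abs_of_nonneg g0, abs_of_nonneg (sub_nonneg.2 g1)]
    have e2 : |(2 : ℝ)| = 2 := by norm_num
    have e3 : |(m : ℝ)| = m := by simp
    rw [e2, e3]
    calc _ ≤ 1 * (1 * |deriv (τ : ℝ → ℝ) x|) + 1 * |deriv (η : ℝ → ℝ) x| +
          2 * m * 1 * |deriv (η : ℝ → ℝ) x| * 2 := by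
          gcongr
          linarith
      _ = _ := by ring
  refine h.trans ((norm_add_le _ _).trans_eq ?_)
  rw [norm_smul, norm_abs_eq_norm, norm_abs_eq_norm, Real.norm_of_nonneg (by positivity)]

theorem le_inner_derivL2_blend (η τ : testFunctions a b) (r : Set.Icc (0 : ℝ) 1) {m : ℕ}
    (hm : m ≠ 0) :
    r * (inner ℝ (derivL2 η) (derivL2 τ) - ∫ x in Set.Ioo a b,
      (η : ℝ → ℝ) x ^ (2 * m) * deriv (η : ℝ → ℝ) x * deriv (τ : ℝ → ℝ) x) -
        2 * m * (r : ℝ) ^ (2 * m) * ‖derivL2 η‖ ^ 2 ≤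
      inner ℝ (derivL2 η) (derivL2 (blend η τ r m)) := by
  have hηc := η.2.1.continuous
  have hη'c := η.2.1.continuous_deriv le_rfl
  have hτ'c := τ.2.1.continuous_deriv le_rfl
  have hbc := (blend η τ r m).2.1.continuous_deriv le_rfl
  have hint : ∀ g : ℝ → ℝ, Continuous g → Integrable g (intervalMeasure a b) := fun g hg =>
    (hg.integrableOn_Icc (a := a) (b := b)).mono_set Set.Ioo_subset_Icc_self
  rw [← real_inner_self_eq_norm_sq, inner_derivL2, inner_derivL2, inner_derivL2,
    ← integral_sub (hint _ (by fun_prop)) (hint _ (by fun_prop)), ← integral_const_mul,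
    ← integral_const_mul, ← integral_sub (hint _ (by fun_prop)) (hint _ (by fun_prop))]
  refine integral_mono (hint _ (by fun_prop)) (hint _ (by fun_prop)) fun x => ?_
  change _ ≤ deriv (η : ℝ → ℝ) x * deriv (blendFun η τ r m) x
  rw [deriv_blendFun η.2.1 τ.2.1]
  have h1 : |(r : ℝ) * (τ : ℝ → ℝ) x| ≤ r := by
    rw [abs_mul, abs_of_nonneg r.2.1]
    exact mul_le_of_le_one_right r.2.1 (τ.2.2.2.2 x)
  -- Pointwise, `η' ξ'` contains `2m η'² (η^(2m) - η^(2m-1) r τ)`, which is at least `-2m r^(2m)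
  -- η'²`; the term `η^(2m) η'²` is nonnegative and is dropped.
  have h2 := abs_pow_two_mul_sub_le (s := (η : ℝ → ℝ) x) hm r.2.1 h1
  have h3 : (η : ℝ → ℝ) x ^ (2 * m - 1) * (η : ℝ → ℝ) x = (η : ℝ → ℝ) x ^ (2 * m) := by
    rw [← pow_succ]
    congr 1
    omega
  obtain ⟨g0, -⟩ := pow_two_mul_mem_Icc (η.2.2.2.2 x) m
  have h4 := mul_nonneg (mul_nonneg (by positivity : (0 : ℝ) ≤ 2 * m) (sub_nonneg.2 h2))
    (mul_self_nonneg (deriv (η : ℝ → ℝ) x))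
  have h5 := mul_nonneg g0 (mul_self_nonneg (deriv (η : ℝ → ℝ) x))
  rw [← h3] at h4 h5 ⊢
  nlinarith [h4, h5]

end blend

/-! ### Additivity of the total variation -/

theorem inner_le_of_mem_closure {a b : ℝ} {w q : LTwo a b} {C : ℝ}
    (hq : q ∈ closure (Set.range (derivL2 (a := a) (b := b))))
    (h : ∀ ξ : testFunctions a b, inner ℝ w (derivL2 ξ) ≤ C) : inner ℝ w q ≤ C := by
  refine closure_minimal (t := {x | inner ℝ w x ≤ C}) ?_
    (isClosed_le (by fun_prop) continuous_const) hq
  rintro _ ⟨ξ, rfl⟩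
  exact h ξ

/-- If `q` is a limit of derivatives of test functions at which the total variation of `u` is
attained, then the total variations of `u` and `l q` add up. -/
theorem inner_add_mul_inner_le {a b l C : ℝ} (hab : a ≤ b) (hl : 0 ≤ l) {u q : LTwo a b}
    (hq : q ∈ closure (Set.range (derivL2 (a := a) (b := b))))
    (hu : ∀ ξ : testFunctions a b, inner ℝ u (derivL2 ξ) ≤ inner ℝ u q)
    (hC : ∀ ξ : testFunctions a b, inner ℝ (u + l • q) (derivL2 ξ) ≤ C)
    (τ : testFunctions a b) : inner ℝ u q + l * inner ℝ q (derivL2 τ) ≤ C := by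
  have blended : ∀ ε > 0, ∃ K : ℝ, ∀ (r : Set.Icc (0 : ℝ) 1) (m : ℕ), m ≠ 0 →
      inner ℝ u q + l * (r * (inner ℝ q (derivL2 τ) -
        (ε * ((b - a) + ‖q‖ ^ 2) + K / (2 * m + 1))) - 2 * m * (r : ℝ) ^ (2 * m) * ‖q‖ ^ 2) ≤
        C := by
    intro ε hε
    obtain ⟨K, hK⟩ := exists_abs_integral_pow_mul_le hab τ hε
    refine ⟨K, fun r m hm => ?_⟩
    -- The inequality is closed in `x` and holds at every `x = η'`, so it passes to `x = q`. There
    -- the defect `⟨u, q⟩ - ⟨u, x⟩` and the error from replacing `q` by `x` both vanish.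
    have h := closure_minimal (t := {x : LTwo a b |
      inner ℝ u x - 4 * m * (inner ℝ u q - inner ℝ u x) +
      l * (r * (inner ℝ x (derivL2 τ) -
        (ε * ((b - a) + ‖x‖ ^ 2) + K / (2 * m + 1))) - 2 * m * (r : ℝ) ^ (2 * m) * ‖x‖ ^ 2 -
        ‖q - x‖ * (‖derivL2 τ‖ + (1 + 4 * m) * ‖x‖)) ≤ C}) ?_
      (isClosed_le (by fun_prop) continuous_const) hq
    · simpa using h
    rintro _ ⟨η, rfl⟩
    refine le_trans ?_ (hC (blend η τ r m))
    rw [inner_add_left, inner_smul_left]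
    refine add_le_add (le_inner_blend η τ r hm hu) (mul_le_mul_of_nonneg_left ?_ hl)
    have h1 := le_inner_derivL2_blend η τ r hm
    have h2 : r * (inner ℝ (derivL2 η) (derivL2 τ) -
        (ε * ((b - a) + ‖derivL2 η‖ ^ 2) + K / (2 * m + 1))) ≤
        r * (inner ℝ (derivL2 η) (derivL2 τ) - ∫ x in Set.Ioo a b,
          (η : ℝ → ℝ) x ^ (2 * m) * deriv (η : ℝ → ℝ) x * deriv (τ : ℝ → ℝ) x) :=
      mul_le_mul_of_nonneg_left (sub_le_sub_left ((le_abs_self _).trans (hK η m)) _) r.2.1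
    have h3 : -(‖q - derivL2 η‖ * (‖derivL2 τ‖ + (1 + 4 * m) * ‖derivL2 η‖)) ≤
        inner ℝ (q - derivL2 η) (derivL2 (blend η τ r m)) :=
      (neg_le_neg (mul_le_mul_of_nonneg_left (norm_derivL2_blend_le η τ r m)
        (norm_nonneg _))).trans (neg_le_of_abs_le (abs_real_inner_le_norm _ _))
    rw [inner_sub_left] at h3
    linarith
  -- The order of limits matters: `K` depends on `ε`, so `m → ∞` precedes `ε → 0`; and `2m r^(2m) →
  -- 0` needs `r < 1`, so `r → 1` comes last.
  have limit_m : ∀ ε > 0, ∀ r : ℝ, 0 ≤ r → r < 1 →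
      inner ℝ u q + l * (r * (inner ℝ q (derivL2 τ) - ε * ((b - a) + ‖q‖ ^ 2))) ≤ C := by
    intro ε hε r hr0 hr1
    obtain ⟨K, hK⟩ := blended ε hε
    have hm2 : Tendsto (fun m : ℕ => 2 * m) atTop atTop :=
      tendsto_id.const_mul_atTop' two_pos
    have t1 : Tendsto (fun m : ℕ => K / (2 * (m : ℝ) + 1)) atTop (𝓝 0) := by
      refine Tendsto.const_div_atTop ?_ K
      exact tendsto_atTop_add_const_right _ _
        (tendsto_natCast_atTop_atTop.const_mul_atTop two_pos)
    have t2 : Tendsto (fun m : ℕ => 2 * (m : ℝ) * r ^ (2 * m)) atTop (𝓝 0) := by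
      have := (tendsto_self_mul_const_pow_of_lt_one hr0 hr1).comp hm2
      refine this.congr fun m => ?_
      simp
    have t := (((((t1.const_add (ε * ((b - a) + ‖q‖ ^ 2))).const_sub
      (inner ℝ q (derivL2 τ))).const_mul r).sub (t2.mul_const (‖q‖ ^ 2))).const_mul l).const_add
      (inner ℝ u q)
    simp only [add_zero, zero_mul, sub_zero] at t
    refine le_of_tendsto t ?_
    filter_upwards [eventually_ne_atTop 0] with m hm
    exact hK ⟨r, hr0, hr1.le⟩ m hm
  have limit_ε : ∀ r : ℝ, 0 ≤ r → r < 1 →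
      inner ℝ u q + l * (r * inner ℝ q (derivL2 τ)) ≤ C := by
    intro r hr0 hr1
    have t : Tendsto (fun ε : ℝ => inner ℝ u q +
        l * (r * (inner ℝ q (derivL2 τ) - ε * ((b - a) + ‖q‖ ^ 2)))) (𝓝[>] 0)
        (𝓝 (inner ℝ u q + l * (r * (inner ℝ q (derivL2 τ) - 0 * ((b - a) + ‖q‖ ^ 2))))) :=
      (Continuous.tendsto (by fun_prop) 0).mono_left nhdsWithin_le_nhds
    rw [zero_mul, sub_zero] at t
    refine le_of_tendsto t ?_
    filter_upwards [self_mem_nhdsWithin] with ε hε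
    exact limit_m ε hε r hr0 hr1
  have t : Tendsto (fun r : ℝ => inner ℝ u q + l * (r * inner ℝ q (derivL2 τ))) (𝓝[<] 1)
      (𝓝 (inner ℝ u q + l * (1 * inner ℝ q (derivL2 τ)))) :=
    (Continuous.tendsto (by fun_prop) 1).mono_left nhdsWithin_le_nhds
  rw [one_mul] at t
  refine le_of_tendsto t ?_
  filter_upwards [Ioo_mem_nhdsLT (zero_lt_one' ℝ)] with r hr
  exact limit_ε r hr.1.le hr.2

/-! ### Dual certificate, optimality and the identity for `J` -/

/-- The minimizer is the residual of the projection of `f` onto the polar set of the total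
variation. -/
theorem exists_dual_certificate {a b l : ℝ} (hl : 0 < l) (f : BV a b) :
    ∃ u : BV a b, ∃ q ∈ closure (Set.range (derivL2 (a := a) (b := b))),
      BV.toL2 f = BV.toL2 u + l • q ∧
      (∀ ξ : testFunctions a b, inner ℝ (BV.toL2 u) (derivL2 ξ) ≤ inner ℝ (BV.toL2 u) q) ∧
      BV.J u = inner ℝ (BV.toL2 u) q := by
  have hconv := (convex_range_derivL2 a b).closure
  have hne : (closure (Set.range (derivL2 (a := a) (b := b)))).Nonempty :=
    ⟨_, subset_closure ⟨⟨_, zero_mem_testFunctions⟩, rfl⟩⟩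
  -- The variational inequality for the projection of `f / l`, multiplied by `l`, says that `q`
  -- maximizes the pairing with `f - l q` over the closure.
  obtain ⟨q, hq, hmin⟩ := exists_norm_eq_iInf_of_complete_convex hne
    isClosed_closure.isComplete hconv (l⁻¹ • BV.toL2 f)
  rw [norm_eq_iInf_iff_real_inner_le_zero hconv hq] at hmin
  have hle : ∀ ξ : testFunctions a b,
      inner ℝ (BV.toL2 f - l • q) (derivL2 ξ) ≤ inner ℝ (BV.toL2 f - l • q) q := by
    intro ξ
    have h := hmin _ (subset_closure ⟨ξ, rfl⟩)
    have e : BV.toL2 f - l • q = l • (l⁻¹ • BV.toL2 f - q) := by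
      rw [smul_sub, smul_inv_smul₀ hl.ne']
    rw [← sub_nonpos, ← inner_sub_right, e, inner_smul_left]
    exact mul_nonpos_of_nonneg_of_nonpos hl.le h
  obtain ⟨u, hu⟩ := exists_toL2_eq hle
  rw [← hu] at hle
  refine ⟨u, q, hq, by rw [hu, sub_add_cancel], hle, le_antisymm (BV.J_le_of_inner_le hle) ?_⟩
  exact inner_le_of_mem_closure hq (BV.inner_le_J u)

/-- Membership of `q` in the closure gives `⟨v, q⟩ ≤ J(v)`, with equality at `u`; expanding the
square leaves a quadratic surplus. The surplus yields uniqueness as well as minimality. -/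
theorem energy_add_le_of_certificate {a b l : ℝ} (hl : 0 ≤ l) {f u : BV a b} {q : LTwo a b}
    (hq : q ∈ closure (Set.range (derivL2 (a := a) (b := b))))
    (hf : BV.toL2 f = BV.toL2 u + l • q) (hJ : BV.J u = inner ℝ (BV.toL2 u) q) (v : BV a b) :
    l * BV.J u + 2⁻¹ * ‖BV.toL2 f - BV.toL2 u‖ ^ 2 + 2⁻¹ * ‖BV.toL2 v - BV.toL2 u‖ ^ 2 ≤
      l * BV.J v + 2⁻¹ * ‖BV.toL2 f - BV.toL2 v‖ ^ 2 := by
  have h := mul_le_mul_of_nonneg_left (inner_le_of_mem_closure hq (BV.inner_le_J v)) hl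
  have e : BV.toL2 f - BV.toL2 v = l • q - (BV.toL2 v - BV.toL2 u) := by rw [hf]; abel
  have e' : BV.toL2 f - BV.toL2 u = l • q := by rw [hf]; abel
  rw [e, e', norm_sub_sq_real (l • q), inner_smul_left, inner_sub_right,
    real_inner_comm (BV.toL2 v) q, real_inner_comm (BV.toL2 u) q, hJ]
  simp only [conj_trivial]
  linarith

/-- Since `f - u = l q`, the upper bound is `inner_add_mul_inner_le` with `C = J(f)`; the lower
bound is the triangle inequality. -/
theorem BV.J_sub_of_certificate {a b l : ℝ} (hab : a ≤ b) (hl : 0 < l) {f u : BV a b}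
    {q : LTwo a b} (hq : q ∈ closure (Set.range (derivL2 (a := a) (b := b))))
    (hf : BV.toL2 f = BV.toL2 u + l • q)
    (hle : ∀ ξ : testFunctions a b, inner ℝ (BV.toL2 u) (derivL2 ξ) ≤ inner ℝ (BV.toL2 u) q)
    (hJ : BV.J u = inner ℝ (BV.toL2 u) q) : BV.J (f - u) = BV.J f - BV.J u := by
  have e : BV.toL2 (f - u) = l • q := by rw [BV.toL2_sub, hf, add_sub_cancel_left]
  refine le_antisymm (BV.J_le_of_inner_le fun τ => ?_) ?_
  · have h := inner_add_mul_inner_le hab hl.le hq hle (C := BV.J f)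
      (fun ξ => by rw [← hf]; exact BV.inner_le_J f ξ) τ
    rw [e, inner_smul_left, hJ]
    simp only [conj_trivial]
    linarith
  · rw [sub_le_iff_le_add]
    refine BV.J_le_of_inner_le fun ξ => ?_
    have h1 := BV.inner_le_J (f - u) ξ
    have h2 := BV.inner_le_J u ξ
    rw [BV.toL2_sub, inner_sub_left] at h1
    linarith

/-! ### The limit of vanishing regularization -/

/-- As a supremum of continuous functionals, `J` is lower semicontinuous in `L²`; `hJ` supplies the
upper bound. -/
theorem tendsto_BV_J {ι : Type*} {F : Filter ι} {a b : ℝ} {f : BV a b} {u : ι → BV a b}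
    (hu : Tendsto (fun i => BV.toL2 (u i)) F (𝓝 (BV.toL2 f)))
    (hJ : ∀ᶠ i in F, BV.J (u i) ≤ BV.J f) : Tendsto (fun i => BV.J (u i)) F (𝓝 (BV.J f)) := by
  refine tendsto_order.2 ⟨fun c hc => ?_, fun c hc => hJ.mono fun i hi => hi.trans_lt hc⟩
  obtain ⟨ξ, hξ⟩ : ∃ ξ : testFunctions a b, c < inner ℝ (BV.toL2 f) (derivL2 ξ) := by
    by_contra! h
    exact not_le.2 hc (BV.J_le_of_inner_le h)
  have t : Tendsto (fun i => inner ℝ (BV.toL2 (u i)) (derivL2 ξ)) F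
      (𝓝 (inner ℝ (BV.toL2 f) (derivL2 ξ))) := hu.inner tendsto_const_nhds
  filter_upwards [t.eventually (lt_mem_nhds hξ)] with i hi
  exact hi.trans_le (BV.inner_le_J _ _)

/-- The competitor `f` has energy `l J(f)`, so `‖f - u‖² ≤ 2 l J(f)`. -/
theorem tendsto_toL2_of_isROFMinimizer {a b : ℝ} (f : BV a b) {u : ℝ → BV a b}
    (hu : ∀ l : ℝ, 0 < l → IsROFMinimizer (f : LOne a b) l (u l)) :
    Tendsto (fun l => BV.toL2 (u l)) (𝓝[>] 0) (𝓝 (BV.toL2 f)) := by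
  rw [tendsto_iff_norm_sub_tendsto_zero]
  have t : Tendsto (fun l : ℝ => √(2 * (l * BV.J f))) (𝓝[>] 0) (𝓝 √(2 * (0 * BV.J f))) :=
    (Continuous.tendsto (by fun_prop) 0).mono_left nhdsWithin_le_nhds
  rw [zero_mul, mul_zero, Real.sqrt_zero] at t
  refine squeeze_zero' (Eventually.of_forall fun _ => norm_nonneg _) ?_ t
  filter_upwards [self_mem_nhdsWithin] with l hl
  have h := (isROFMinimizer_iff hl f (u l)).1 (hu l hl) f
  rw [sub_self, norm_zero, norm_sub_rev] at h
  refine Real.le_sqrt_of_sq_le ?_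
  have := mul_nonneg (le_of_lt hl) (BV.J_nonneg (u l))
  linarith

theorem mainTheorem4 (a b : ℝ) (hab : a < b) (f : BV a b) :
    (∀ l : ℝ, 0 < l → ∃! u : BV a b, IsROFMinimizer (f : LOne a b) l u) ∧
    ∀ u : ℝ → BV a b, (∀ l : ℝ, 0 < l → IsROFMinimizer (f : LOne a b) l (u l)) →
      (∀ l : ℝ, 0 < l → BV.J (f - u l) = BV.J f - BV.J (u l)) ∧
      Tendsto (fun l : ℝ => BV.J (f - u l)) (𝓝[>] 0) (𝓝 0) ∧
      Tendsto (fun l : ℝ => BV.bvNorm (f - u l)) (𝓝[>] 0) (𝓝 0) := by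
  have main : ∀ l : ℝ, 0 < l → ∃ u : BV a b, IsROFMinimizer (f : LOne a b) l u ∧
      (∀ v, IsROFMinimizer (f : LOne a b) l v → v = u) ∧ BV.J (f - u) = BV.J f - BV.J u := by
    intro l hl
    obtain ⟨u, q, hq, hf, hle, hJ⟩ := exists_dual_certificate hl f
    have hen := energy_add_le_of_certificate hl.le hq hf hJ
    refine ⟨u, (isROFMinimizer_iff hl f u).2 fun v => ?_, fun v hv => ?_,
      BV.J_sub_of_certificate hab.le hl hq hf hle hJ⟩
    · exact le_trans (le_add_of_nonneg_right (by positivity)) (hen v)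
    · have h := (isROFMinimizer_iff hl f v).1 hv u
      have h0 : ‖BV.toL2 v - BV.toL2 u‖ ^ 2 ≤ 0 := by linarith [hen v]
      have h1 : ‖BV.toL2 v - BV.toL2 u‖ = 0 := by
        simpa using le_antisymm h0 (sq_nonneg _)
      exact BV.toL2_injective (sub_eq_zero.1 (norm_eq_zero.1 h1))
  refine ⟨fun l hl => ?_, fun u hu => ?_⟩
  · obtain ⟨u, h1, h2, -⟩ := main l hl
    exact ⟨u, h1, h2⟩
  have hJ : ∀ l : ℝ, 0 < l → BV.J (f - u l) = BV.J f - BV.J (u l) := by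
    intro l hl
    obtain ⟨w, -, h2, h3⟩ := main l hl
    rw [h2 _ (hu l hl), h3]
  have tL2 := tendsto_toL2_of_isROFMinimizer f hu
  have tJ : Tendsto (fun l : ℝ => BV.J (f - u l)) (𝓝[>] 0) (𝓝 0) := by
    -- The bound `J(u) ≤ J(f)` is read off from the identity and `J(f - u) ≥ 0`.
    have t := (tendsto_BV_J tL2 (by
      filter_upwards [self_mem_nhdsWithin] with l hl
      have := BV.J_nonneg (f - u l)
      rw [hJ l hl] at this
      linarith)).const_sub (BV.J f)
    rw [sub_self] at t
    refine t.congr' ?_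
    filter_upwards [self_mem_nhdsWithin] with l hl
    exact (hJ l hl).symm
  refine ⟨hJ, tJ, ?_⟩
  have tn : Tendsto (fun l : ℝ => ‖((f - u l : BV a b) : LOne a b)‖) (𝓝[>] 0) (𝓝 0) := by
    have t := ((tL2.const_sub (BV.toL2 f)).norm).mul_const
      ((intervalMeasure a b Set.univ) ^ (1 / 2 : ℝ)).toReal
    rw [sub_self, norm_zero, zero_mul] at t
    refine squeeze_zero (fun _ => norm_nonneg _) (fun l => ?_) t
    rw [← BV.toL2_sub]
    exact BV.norm_le_mul_norm_toL2 _
  simpa [BV.bvNorm] using tJ.add tn
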